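/- Let $\Bbbk$ be an algebraically closed field of characteristic $0$, let $g\in\mathbb N$, and let $\Bbbk\langle x_1,\dots,x_g\rangle$ be the free $\Bbbk$-algebra on $g$ freely noncommuting variables. The free locus of a noncommutative polynomial $f\in\Bbbk\langle x_1,\dots,x_g\rangle$ is the set $$\mathscr Z(f)=\bigsqcup_{n\ge 1}\{X\in M_n(\Bbbk)^g : \det f(X)=0\}.$$ A monic pencil of size $d\ge1$ is $L=I_d-\sum_{j=1}^g A_jx_j$ with $A_1,\dots,A_g\in M_d(\Bbbk)$, and its free locus is $$\mathscr Z(L)=\bigsqcup_{n\ge 1}\Big\{X\in M_n(\Bbbk)^g : \det\Big(I_{dn}-\sum_{j=1}^g A_j\otimes X_j\Big)=0\Big\}.$$ The pencil $L$ is called flip-poly if there are matrices $N_j,E_j\in M_d(\Bbbk)$ with $A_j=N_j+E_j$ for $j=1,\dots,g$ such that $N_1,\dots,N_g$ are jointly nilpotent (for some $m$, every product of $m$ of the matrices $N_j$, repetitions allowed, is zero) and $\bigcap_{j=1}^g\ker E_j$ has codimension at most $1$ in $\Bbbk^d$. Then the set of free loci of noncommutative polynomials with nonzero constant term coincides with the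 set of free loci of flip-poly pencils: $$\{\mathscr Z(f) : f\in\Bbbk\langle x_1,\dots,x_g\rangle,\ f(0)\neq0\}=\{\mathscr Z(L) : L \text{ a flip-poly monic pencil in } x_1,\dots,x_g\}.$$ -/

import Mathlib

open scoped Kronecker

namespace FreeLoci

/-- The space of all `g`-tuples of square matrices of equal size `n ≥ 1` over `K`: the disjoint
union over `n` of the spaces of `g`-tuples of `n × n` matrices. -/
abbrev MatTuple (K : Type*) (g : ℕ) : Type _ :=
  Σ n : ℕ+, Fin g → Matrix (Fin n) (Fin n) K

/-- The free algebra of noncommutative polynomials in `g` freely noncommuting variables. -/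
abbrev NCPoly (K : Type*) [Field K] (g : ℕ) : Type _ := FreeAlgebra K (Fin g)

/-- Evaluation of a noncommutative polynomial at a tuple of elements of a `K`-algebra. -/
def NCPoly.eval {K : Type*} [Field K] {g : ℕ} {R : Type*} [Ring R] [Algebra K R]
    (X : Fin g → R) (f : NCPoly K g) : R :=
  FreeAlgebra.lift K X f

/-- The free locus of a noncommutative polynomial `f`: all `X` with `det f(X) = 0`. -/
def NCPoly.freeLocus {K : Type*} [Field K] {g : ℕ} (f : NCPoly K g) : Set (MatTuple K g) :=
  {X | (NCPoly.eval X.2 f).det = 0}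

/-- A monic linear pencil `L = I - ∑ j, A j * x j` of size `d ≥ 1`, given by its coefficients. -/
structure MonicPencil (K : Type*) (g : ℕ) where
  /-- The size `d` of the pencil. -/
  size : ℕ+
  /-- The coefficients `A j`. -/
  coeff : Fin g → Matrix (Fin size) (Fin size) K

/-- The evaluation `L(X) = I - ∑ j, A j ⊗ X j` at a tuple of `n × n` matrices. -/
def MonicPencil.eval {K : Type*} [Field K] {g : ℕ} (L : MonicPencil K g) {n : ℕ}
    (X : Fin g → Matrix (Fin n) (Fin n) K) :
    Matrix (Fin L.size × Fin n) (Fin L.size × Fin n) K :=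
  1 - ∑ j, L.coeff j ⊗ₖ X j

/-- The free locus of a monic pencil `L`: all `X` with `det L(X) = 0`. -/
def MonicPencil.freeLocus {K : Type*} [Field K] {g : ℕ} (L : MonicPencil K g) :
    Set (MatTuple K g) :=
  {X | (L.eval X.2).det = 0}

/-- Matrices `N 1, …, N g` are jointly nilpotent if for some `m` all products of `m` of them
(with repetitions, in any order) vanish. -/
def JointlyNilpotent {K : Type*} [Field K] {g d : ℕ}
    (N : Fin g → Matrix (Fin d) (Fin d) K) : Prop :=
  ∃ m : ℕ, ∀ w : List (Fin g), w.length = m → (w.map N).prod = 0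

/-- A monic pencil is flip-poly if its coefficients are `N j + E j` with `N` jointly nilpotent and
the common kernel of the `E j` of codimension at most one. -/
def MonicPencil.IsFlipPoly {K : Type*} [Field K] {g : ℕ} (L : MonicPencil K g) : Prop :=
  ∃ N E : Fin g → Matrix (Fin L.size) (Fin L.size) K,
    (∀ j, L.coeff j = N j + E j) ∧
    JointlyNilpotent N ∧
    Module.finrank K ((Fin L.size → K) ⧸ ⨅ j, LinearMap.ker (Matrix.toLin' (E j))) ≤ 1

end FreeLoci

/-!
If `N` is jointly nilpotent, then `Λ = ∑ j, N j * x j` is nilpotent, so `1 - Λ` is invertible over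
the free algebra and every row `φ` of scalars has the form `φ = R * (1 - Λ)` for a row `R` of
polynomials. With `β = ∑ j, B j * x j` this gives the factorization
`1 - ∑ j, (N j + B j * φ) * x j = (1 - β * R) * (1 - Λ)`, and by the identity
`det (1 - β R) = det (1 - R β)` the flip-poly pencil on the left has the free locus of the single
polynomial `1 - R * β`.

Conversely, a polynomial with nonzero constant term is, up to a scalar, `1 - ∑ j, p j * x j`. If `R`
is the row of all words of length at most `m`, then `R * (1 - Λ)` is the indicator row of the empty
word when `N j` is the shift appending the letter `j`, and every such polynomial is of the form
`1 - R * β` once `m` bounds the degrees of the `p j`: take `B j` to be the coefficients of `p j`.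
-/

namespace FreeLoci

open Matrix

section BlockMap

variable {R S ι κ μ n : Type*} [Ring R] [CommRing S] [Fintype n] [DecidableEq n]

/-- The amplification of a representation `ρ` of `R` by `n × n` matrices: `ρ` is applied to every
entry of a matrix over `R`, and the result is read as a block matrix. -/
def blockMap (ρ : R →+* Matrix n n S) (M : Matrix ι κ R) : Matrix (ι × n) (κ × n) S :=
  comp ι κ n n S (M.map ρ)

variable (ρ : R →+* Matrix n n S)

theorem blockMap_apply (M : Matrix ι κ R) (p : ι × n) (q : κ × n) :
    blockMap ρ M p q = ρ (M p.1 q.1) p.2 q.2 :=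
  rfl

theorem blockMap_mul [Fintype κ] (M : Matrix ι κ R) (M' : Matrix κ μ R) :
    blockMap ρ (M * M') = blockMap ρ M * blockMap ρ M' := by
  ext p q
  simp only [blockMap_apply, Matrix.mul_apply, map_sum, map_mul, Matrix.sum_apply,
    Fintype.sum_prod_type]

theorem blockMap_sub (M M' : Matrix ι κ R) :
    blockMap ρ (M - M') = blockMap ρ M - blockMap ρ M' := by
  ext p q
  simp only [blockMap_apply, Matrix.sub_apply, map_sub]

theorem blockMap_one [DecidableEq ι] : blockMap ρ (1 : Matrix ι ι R) = 1 := by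
  rw [blockMap, Matrix.map_one _ (map_zero ρ) (map_one ρ), comp_one]

theorem isUnit_blockMap [Fintype ι] [DecidableEq ι] {M : Matrix ι ι R} (hM : IsUnit M) :
    IsUnit (blockMap ρ M) :=
  (isUnit_comp_iff ι n S).2 (hM.map ρ.mapMatrix)

theorem det_blockMap_one_sub_mul_comm [Fintype ι] [DecidableEq ι] [Fintype κ] [DecidableEq κ]
    (M : Matrix ι κ R) (M' : Matrix κ ι R) :
    (blockMap ρ (1 - M * M')).det = (blockMap ρ (1 - M' * M)).det := by
  simp only [blockMap_sub, blockMap_one, blockMap_mul]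
  exact det_one_sub_mul_comm _ _

theorem det_blockMap_of_unique [Unique ι] [Fintype ι] [DecidableEq ι] (M : Matrix ι ι R) :
    (blockMap ρ M).det = (ρ (M default default)).det := by
  rw [← det_reindex_self (Equiv.uniqueProd n ι)]
  rfl

end BlockMap

section LinearForm

variable {K : Type*} [Field K] {g : ℕ} {ι κ μ : Type*}

/-- The homogeneous linear matrix polynomial `∑ j, A j * x j`, as a matrix over the free algebra. -/
def linearForm (A : Fin g → Matrix ι κ K) : Matrix ι κ (NCPoly K g) :=
  ∑ j, FreeAlgebra.ι K j • (A j).map (algebraMap K (NCPoly K g))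

theorem linearForm_apply (A : Fin g → Matrix ι κ K) (i : ι) (k : κ) :
    linearForm A i k = ∑ j, A j i k • FreeAlgebra.ι K j := by
  simp only [linearForm, Matrix.sum_apply, Matrix.smul_apply, map_apply, smul_eq_mul,
    Algebra.smul_def, Algebra.commutes]

theorem linearForm_add (A B : Fin g → Matrix ι κ K) :
    linearForm (A + B) = linearForm A + linearForm B := by
  ext i k
  simp only [linearForm_apply, Matrix.add_apply, Pi.add_apply, add_smul,
    Finset.sum_add_distrib]

theorem linearForm_mul_map [Fintype κ] (A : Fin g → Matrix ι κ K) (M : Matrix κ μ K) :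
    linearForm A * M.map (algebraMap K (NCPoly K g)) = linearForm fun j => A j * M := by
  simp only [linearForm, Matrix.sum_mul, Matrix.smul_mul, Matrix.map_mul]

theorem map_mul_linearForm [Fintype κ] (M : Matrix ι κ K) (A : Fin g → Matrix κ μ K) :
    M.map (algebraMap K (NCPoly K g)) * linearForm A = linearForm fun j => M * A j := by
  ext i k
  simp only [mul_apply, map_apply, linearForm_apply, Finset.mul_sum, Finset.sum_smul,
    ← Algebra.smul_def, smul_smul]
  exact Finset.sum_comm

theorem replicateRow_mul_linearForm_replicateCol_apply [Fintype ι] (r : ι → NCPoly K g)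
    (c : Fin g → ι → K) (a : κ) (b : μ) :
    (replicateRow κ r * linearForm fun j => replicateCol μ (c j)) a b =
      ∑ j, (∑ i, c j i • r i) * FreeAlgebra.ι K j := by
  simp only [Matrix.mul_apply, replicateRow_apply, linearForm_apply, replicateCol_apply,
    Finset.mul_sum, Finset.sum_mul, mul_smul_comm, smul_mul_assoc]
  exact Finset.sum_comm

theorem blockMap_linearForm {n : ℕ} (X : Fin g → Matrix (Fin n) (Fin n) K)
    (A : Fin g → Matrix ι κ K) :
    blockMap (FreeAlgebra.lift K X : NCPoly K g →+* _) (linearForm A) = ∑ j, A j ⊗ₖ X j := by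
  ext p q
  simp [blockMap_apply, linearForm_apply, Matrix.sum_apply]

theorem MonicPencil.eval_eq_blockMap (L : MonicPencil K g) {n : ℕ}
    (X : Fin g → Matrix (Fin n) (Fin n) K) :
    L.eval X = blockMap (FreeAlgebra.lift K X : NCPoly K g →+* _) (1 - linearForm L.coeff) := by
  rw [blockMap_sub, blockMap_one, blockMap_linearForm, MonicPencil.eval]

theorem isNilpotent_linearForm {d : ℕ} {N : Fin g → Matrix (Fin d) (Fin d) K}
    (hN : JointlyNilpotent N) : IsNilpotent (linearForm N) := by
  obtain ⟨m, hm⟩ := hN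
  have map_mul_pow_eq_zero (k : ℕ) : ∀ M : Matrix (Fin d) (Fin d) K,
      (∀ w : List (Fin g), w.length = k → M * (w.map N).prod = 0) →
      M.map (algebraMap K (NCPoly K g)) * linearForm N ^ k = 0 := by
    induction k with
    | zero =>
      intro M hM
      simp [show M = 0 by simpa using hM []]
    | succ k ih =>
      intro M hM
      rw [pow_succ', ← mul_assoc, map_mul_linearForm, linearForm, Finset.sum_mul]
      refine Finset.sum_eq_zero fun j _ => ?_
      rw [smul_mul, ih (M * N j) fun w hw => ?_, smul_zero]
      simpa [mul_assoc] using hM (j :: w) (by simp [hw])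
  refine ⟨m, ?_⟩
  simpa using map_mul_pow_eq_zero m 1 fun w hw => by rw [hm w hw, mul_zero]

theorem one_sub_linearForm_add_mul [Fintype ι] [DecidableEq ι] [Fintype κ]
    {N : Fin g → Matrix ι ι K} (B : Fin g → Matrix ι κ K) {φ : Matrix κ ι K}
    {R : Matrix κ ι (NCPoly K g)} (hR : R * (1 - linearForm N) = φ.map (algebraMap K _)) :
    1 - linearForm (fun j => N j + B j * φ) = (1 - linearForm B * R) * (1 - linearForm N) := by
  rw [show (fun j => N j + B j * φ) = N + fun j => B j * φ from rfl, linearForm_add,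
    ← linearForm_mul_map, ← hR, Matrix.sub_mul, Matrix.one_mul, Matrix.mul_assoc, sub_sub]

theorem freeLocus_eq_of_mul_one_sub_linearForm {L : MonicPencil K g}
    {N : Fin g → Matrix (Fin L.size) (Fin L.size) K} {B : Fin g → Matrix (Fin L.size) (Fin 1) K}
    {φ : Matrix (Fin 1) (Fin L.size) K} {R : Matrix (Fin 1) (Fin L.size) (NCPoly K g)}
    (hL : ∀ j, L.coeff j = N j + B j * φ) (hN : JointlyNilpotent N)
    (hR : R * (1 - linearForm N) = φ.map (algebraMap K _)) :
    L.freeLocus = NCPoly.freeLocus (1 - (R * linearForm B) 0 0) := by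
  ext X
  let ρ : NCPoly K g →+* Matrix (Fin X.1) (Fin X.1) K := FreeAlgebra.lift K X.2
  have det_ne_zero : (blockMap ρ (1 - linearForm N)).det ≠ 0 :=
    ((isUnit_iff_isUnit_det _).1
      (isUnit_blockMap ρ (isNilpotent_linearForm hN).isUnit_one_sub)).ne_zero
  have det_eq : (L.eval X.2).det =
      (NCPoly.eval X.2 (1 - (R * linearForm B) 0 0)).det *
        (blockMap ρ (1 - linearForm N)).det := by
    rw [L.eval_eq_blockMap, funext hL, one_sub_linearForm_add_mul B hR, blockMap_mul, det_mul,
      det_blockMap_one_sub_mul_comm, det_blockMap_of_unique]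
    rfl
  change (L.eval X.2).det = 0 ↔ (NCPoly.eval X.2 _).det = 0
  rw [det_eq, mul_eq_zero, or_iff_left det_ne_zero]

end LinearForm

theorem finrank_quotient_iInf_ker_toLin'_le_iff {K m n κ : Type*} [Field K] [Fintype n]
    [DecidableEq n] (E : κ → Matrix m n K) (r : ℕ) :
    Module.finrank K ((n → K) ⧸ ⨅ j, LinearMap.ker (E j).toLin') ≤ r ↔
      ∃ (B : κ → Matrix m (Fin r) K) (φ : Matrix (Fin r) n K), ∀ j, E j = B j * φ := by
  set W : Submodule K (n → K) := ⨅ j, LinearMap.ker (E j).toLin'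
  constructor
  · intro hr
    obtain ⟨s, hs⟩ : ∃ s : ((n → K) ⧸ W) →ₗ[K] (Fin r → K), Function.Injective s :=
      Module.Free.exists_linearMap_injective_of_linearIndependent_of_lift_rank_le
        (Pi.basisFun K (Fin r)).linearIndependent (by simpa [← Module.finrank_eq_rank] using hr)
    obtain ⟨t, ht⟩ := s.exists_leftInverse_of_injective (LinearMap.ker_eq_bot.2 hs)
    refine ⟨fun j => LinearMap.toMatrix' (W.liftQ (E j).toLin' (iInf_le _ j) ∘ₗ t),
      LinearMap.toMatrix' (s ∘ₗ W.mkQ), fun j => ?_⟩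
    rw [← LinearMap.toMatrix'_comp, LinearMap.comp_assoc, ← LinearMap.comp_assoc _ s, ht,
      LinearMap.id_comp, Submodule.liftQ_mkQ, LinearMap.toMatrix'_toLin']
  · rintro ⟨B, φ, hE⟩
    have ker_le : LinearMap.ker φ.toLin' ≤ W := le_iInf fun j => by
      rw [hE, toLin'_mul]
      exact LinearMap.ker_le_ker_comp _ _
    calc Module.finrank K ((n → K) ⧸ W)
        ≤ Module.finrank K ((n → K) ⧸ LinearMap.ker φ.toLin') :=
          LinearMap.finrank_le_finrank_of_surjective (Submodule.factor_surjective ker_le)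
      _ = Module.finrank K (LinearMap.range φ.toLin') := φ.toLin'.quotKerEquivRange.finrank_eq
      _ ≤ Module.finrank K (Fin r → K) := Submodule.finrank_le _
      _ = r := Module.finrank_fin_fun K

section Words

variable {K : Type*} [Field K] {g : ℕ} {ι : Type*}

/-- The monomial `x_{j₁} ⋯ x_{jₖ}` attached to the word `[j₁, …, jₖ]`. -/
def wordMonomial (K : Type*) [Field K] (w : List (Fin g)) : NCPoly K g :=
  (w.map (FreeAlgebra.ι K)).prod

theorem wordMonomial_append (v w : List (Fin g)) :
    wordMonomial K (v ++ w) = wordMonomial K v * wordMonomial K w := by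
  simp [wordMonomial]

/-- The space of noncommutative polynomials of degree at most `m`. -/
def degreeLE (K : Type*) [Field K] (g m : ℕ) : Submodule K (NCPoly K g) :=
  Submodule.span K (wordMonomial K '' {w | w.length ≤ m})

theorem degreeLE_mono : Monotone (degreeLE K g) := fun _ _ h =>
  Submodule.span_mono (Set.image_mono fun _ hw => le_trans hw h)

theorem wordMonomial_mem_degreeLE (w : List (Fin g)) : wordMonomial K w ∈ degreeLE K g w.length :=
  Submodule.subset_span ⟨w, le_refl w.length, rfl⟩

theorem mul_mem_degreeLE {m n : ℕ} {p q : NCPoly K g} (hp : p ∈ degreeLE K g m)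
    (hq : q ∈ degreeLE K g n) : p * q ∈ degreeLE K g (m + n) := by
  have hpq := Submodule.mul_mem_mul hp hq
  rw [degreeLE, degreeLE, Submodule.span_mul_span] at hpq
  refine Submodule.span_mono ?_ hpq
  rintro _ ⟨_, ⟨v, hv, rfl⟩, _, ⟨w, hw, rfl⟩, rfl⟩
  exact ⟨v ++ w, List.length_append.trans_le (add_le_add hv hw), wordMonomial_append v w⟩

theorem exists_mem_degreeLE (p : NCPoly K g) : ∃ m, p ∈ degreeLE K g m := by
  induction p using FreeAlgebra.induction with
  | grade0 t =>
    rw [Algebra.algebraMap_eq_smul_one]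
    exact ⟨0, Submodule.smul_mem _ t (wordMonomial_mem_degreeLE [])⟩
  | grade1 j => exact ⟨1, by simpa [wordMonomial] using wordMonomial_mem_degreeLE (K := K) [j]⟩
  | mul p q hp hq =>
    obtain ⟨m, hp⟩ := hp
    obtain ⟨n, hq⟩ := hq
    exact ⟨m + n, mul_mem_degreeLE hp hq⟩
  | add p q hp hq =>
    obtain ⟨m, hp⟩ := hp
    obtain ⟨n, hq⟩ := hq
    exact ⟨max m n, add_mem (degreeLE_mono (le_max_left m n) hp)
      (degreeLE_mono (le_max_right m n) hq)⟩

theorem sub_algebraMap_eval_zero_mem_span (f : NCPoly K g) :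
    f - algebraMap K _ (NCPoly.eval (0 : Fin g → K) f) ∈
      Ideal.span (Set.range (FreeAlgebra.ι K : Fin g → NCPoly K g)) := by
  induction f using FreeAlgebra.induction with
  | grade0 t => simp [NCPoly.eval]
  | grade1 j => simpa [NCPoly.eval] using Ideal.subset_span (Set.mem_range_self j)
  | mul p q hp hq =>
    have mul_sub_eq (s t : K) : p * q - algebraMap K _ (s * t) =
        p * (q - algebraMap K _ t) + algebraMap K _ t * (p - algebraMap K _ s) := by
      rw [map_mul, mul_sub, mul_sub, Algebra.commutes t, ← map_mul, ← map_mul, mul_comm t,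
        sub_add_sub_cancel]
    rw [NCPoly.eval, map_mul, mul_sub_eq]
    exact add_mem (Ideal.mul_mem_left _ _ hq) (Ideal.mul_mem_left _ _ hp)
  | add p q hp hq =>
    rw [NCPoly.eval, map_add, map_add, add_sub_add_comm]
    exact add_mem hp hq

/-- The transfer matrices of the automaton whose states `i` carry the words `e i` and in which
reading the letter `j` appends `j` to the current word. -/
def wordShift (K : Type*) [Field K] (e : ι → List (Fin g)) (j : Fin g) : Matrix ι ι K :=
  Matrix.of fun i k => if e k = e i ++ [j] then 1 else 0

theorem jointlyNilpotent_of_lt {d : ℕ} {N : Fin g → Matrix (Fin d) (Fin d) K} (level : Fin d → ℕ)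
    (hN : ∀ j i k, N j i k ≠ 0 → level i < level k) : JointlyNilpotent N := by
  have level_add_length_le (w : List (Fin g)) :
      ∀ i k, (w.map N).prod i k ≠ 0 → level i + w.length ≤ level k := by
    induction w with
    | nil =>
      intro i k h
      obtain rfl : i = k := by
        by_contra hik
        exact h (one_apply_ne hik)
      simp
    | cons j w ih =>
      intro i k h
      rw [List.map_cons, List.prod_cons, mul_apply] at h
      obtain ⟨l, -, hl⟩ := Finset.exists_ne_zero_of_sum_ne_zero h
      have hil := hN j i l (left_ne_zero_of_mul hl)
      have hlk := ih l k (right_ne_zero_of_mul hl)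
      simp only [List.length_cons]
      omega
  refine ⟨Finset.univ.sup level + 1, fun w hw => ?_⟩
  ext i k
  by_contra h
  have hik := level_add_length_le w i k h
  have hk : level k ≤ Finset.univ.sup level := Finset.le_sup (Finset.mem_univ k)
  omega

theorem jointlyNilpotent_wordShift {d : ℕ} (e : Fin d → List (Fin g)) :
    JointlyNilpotent (wordShift K e) := by
  refine jointlyNilpotent_of_lt (fun i => (e i).length) fun j i k h => ?_
  have hk : e k = e i ++ [j] := by
    by_contra hne
    exact h (if_neg hne)
  simp [hk]

theorem replicateRow_wordMonomial_mul_one_sub_linearForm {κ : Type*} [Fintype ι] [DecidableEq ι]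
    {e : ι → List (Fin g)} (he : Function.Injective e)
    (hprefix : ∀ k w j, e k = w ++ [j] → w ∈ Set.range e) :
    replicateRow κ (fun i => wordMonomial K (e i)) * (1 - linearForm (wordShift K e)) =
      (replicateRow κ fun k => if e k = [] then (1 : K) else 0).map (algebraMap K _) := by
  rw [Matrix.mul_sub, Matrix.mul_one, sub_eq_iff_eq_add]
  ext - k
  simp only [Matrix.add_apply, mul_apply, map_apply, replicateRow_apply, linearForm_apply,
    wordShift, Matrix.of_apply, ite_smul, one_smul, zero_smul]
  rcases List.eq_nil_or_concat' (e k) with hk | ⟨w, j, hk⟩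
  · simp [hk, wordMonomial]
  · obtain ⟨i, rfl⟩ := hprefix k w j hk
    have hshift (i' : ι) (j' : Fin g) : e i ++ [j] = e i' ++ [j'] ↔ i = i' ∧ j = j' := by
      simp [he.eq_iff]
    simp [hk, hshift, ite_and, wordMonomial]

end Words

section FlipPoly

variable {K : Type*} [Field K] {g : ℕ}

theorem MonicPencil.IsFlipPoly.exists_freeLocus_eq {L : MonicPencil K g} (hL : L.IsFlipPoly) :
    ∃ f : NCPoly K g, NCPoly.eval (0 : Fin g → K) f ≠ 0 ∧ f.freeLocus = L.freeLocus := by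
  obtain ⟨N, E, hA, hN, hE⟩ := hL
  obtain ⟨B, φ, hB⟩ := (finrank_quotient_iInf_ker_toLin'_le_iff E 1).1 hE
  obtain ⟨T, hT⟩ := (isNilpotent_linearForm hN).isUnit_one_sub.exists_left_inv
  obtain ⟨R, hR⟩ : ∃ R : Matrix (Fin 1) (Fin L.size) (NCPoly K g),
      R * (1 - linearForm N) = φ.map (algebraMap K _) :=
    ⟨φ.map (algebraMap K (NCPoly K g)) * T, by rw [Matrix.mul_assoc, hT, Matrix.mul_one]⟩
  have eval_zero : NCPoly.eval (0 : Fin g → K) (1 - (R * linearForm B) 0 0) = 1 := by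
    simp [NCPoly.eval, Matrix.mul_apply, linearForm_apply]
  exact ⟨1 - (R * linearForm B) 0 0, eval_zero ▸ one_ne_zero,
    (freeLocus_eq_of_mul_one_sub_linearForm (fun j => by rw [hA, hB]) hN hR).symm⟩

theorem exists_isFlipPoly_freeLocus_eq_one_sub (p : Fin g → NCPoly K g) :
    ∃ L : MonicPencil K g, L.IsFlipPoly ∧
      L.freeLocus = NCPoly.freeLocus (1 - ∑ j, p j * FreeAlgebra.ι K j) := by
  choose deg hdeg using fun j => exists_mem_degreeLE (p j)
  let m := Finset.univ.sup deg
  obtain ⟨d, e, e_injective, range_e⟩ := (List.finite_length_le (Fin g) m).fin_param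
  have coeffs (j : Fin g) : ∃ c : Fin d → K, ∑ i, c i • wordMonomial K (e i) = p j := by
    rw [← Submodule.mem_span_range_iff_exists_fun, ← Function.comp_def, Set.range_comp, range_e]
    exact degreeLE_mono (Finset.le_sup (Finset.mem_univ j)) (hdeg j)
  choose c hc using coeffs
  have prefix_mem (k : Fin d) (w : List (Fin g)) (j : Fin g) (hk : e k = w ++ [j]) :
      w ∈ Set.range e := by
    have hlen : w ++ [j] ∈ Set.range e := ⟨k, hk⟩
    rw [range_e] at hlen ⊢
    exact (List.prefix_append w [j]).length_le.trans hlen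
  obtain ⟨start, -⟩ : [] ∈ Set.range e := range_e ▸ Nat.zero_le m
  let N := wordShift K e
  let B (j : Fin g) : Matrix (Fin d) (Fin 1) K := replicateCol (Fin 1) (c j)
  let φ : Matrix (Fin 1) (Fin d) K := replicateRow (Fin 1) fun k => if e k = [] then 1 else 0
  have hN : JointlyNilpotent N := jointlyNilpotent_wordShift e
  let L : MonicPencil K g := ⟨⟨d, start.pos⟩, fun j => N j + B j * φ⟩
  refine ⟨L, ⟨N, fun j => B j * φ, fun _ => rfl, hN,
    (finrank_quotient_iInf_ker_toLin'_le_iff _ 1).2 ⟨B, φ, fun _ => rfl⟩⟩, ?_⟩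
  rw [freeLocus_eq_of_mul_one_sub_linearForm (L := L) (fun _ => rfl) hN
    (replicateRow_wordMonomial_mul_one_sub_linearForm e_injective prefix_mem)]
  congr 2
  exact (replicateRow_mul_linearForm_replicateCol_apply _ c 0 0).trans (by simp only [hc])

theorem NCPoly.freeLocus_smul {t : K} (ht : t ≠ 0) (f : NCPoly K g) :
    (t • f).freeLocus = f.freeLocus := by
  ext X
  simp [NCPoly.freeLocus, NCPoly.eval, ht]

theorem NCPoly.exists_isFlipPoly_freeLocus_eq {f : NCPoly K g}
    (hf : NCPoly.eval (0 : Fin g → K) f ≠ 0) :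
    ∃ L : MonicPencil K g, L.IsFlipPoly ∧ L.freeLocus = f.freeLocus := by
  obtain ⟨p, hp⟩ := Ideal.mem_span_range_iff_exists_fun.1 (sub_algebraMap_eval_zero_mem_span f)
  set t := NCPoly.eval (0 : Fin g → K) f
  obtain ⟨L, hL, hLf⟩ := exists_isFlipPoly_freeLocus_eq_one_sub fun j => -(t⁻¹ • p j)
  refine ⟨L, hL, ?_⟩
  have smul_eq : t • (1 - ∑ j, -(t⁻¹ • p j) * FreeAlgebra.ι K j) = f := by
    simp [smul_sub, ← Finset.smul_sum, hf, hp, Algebra.algebraMap_eq_smul_one]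
  rw [hLf, ← NCPoly.freeLocus_smul hf, smul_eq]

end FlipPoly

end FreeLoci

theorem corollary5p5_general (K : Type*) [Field K] (g : ℕ) :
    {V : Set (FreeLoci.MatTuple K g) |
        ∃ f : FreeLoci.NCPoly K g,
          FreeLoci.NCPoly.eval (0 : Fin g → K) f ≠ 0 ∧ f.freeLocus = V} =
      {V : Set (FreeLoci.MatTuple K g) |
        ∃ L : FreeLoci.MonicPencil K g, L.IsFlipPoly ∧ L.freeLocus = V} := by
  ext V
  constructor
  · rintro ⟨f, hf, rfl⟩
    exact FreeLoci.NCPoly.exists_isFlipPoly_freeLocus_eq hf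
  · rintro ⟨L, hL, rfl⟩
    exact hL.exists_freeLocus_eq

theorem corollary5p5 (K : Type*) [Field K] [IsAlgClosed K] [CharZero K] (g : ℕ) :
    {V : Set (FreeLoci.MatTuple K g) |
        ∃ f : FreeLoci.NCPoly K g,
          FreeLoci.NCPoly.eval (0 : Fin g → K) f ≠ 0 ∧ f.freeLocus = V} =
      {V : Set (FreeLoci.MatTuple K g) |
        ∃ L : FreeLoci.MonicPencil K g, L.IsFlipPoly ∧ L.freeLocus = V} :=
  corollary5p5_general K g
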